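/- Let $\Sigma$ be a compact 3-manifold with boundary, and let $\tilde\Sigma$ be the space obtained from $\Sigma$ by coning off each connected component of $\partial\Sigma$ to a point. Let $\mathcal T$ be an ideal triangulation of $\Sigma$, that is, a triangulation of $\tilde\Sigma$ (finitely many tetrahedra whose faces are glued in pairs by affine maps) whose vertex set $V$ is exactly the set of cone points. A hyper-ideal tetrahedron is a compact convex polyhedron in $\mathbb H^3$ diffeomorphic to a truncated Euclidean tetrahedron, with four right-angled hexagonal faces and four triangular faces (the vertex triangles $\Delta_i$), each orthogonal to the three adjacent hexagonal faces; its edges $\{ij\}$ are the intersections of pairs of hexagonal faces. A generalized sphere packing metric on $(\Sigma,\mathcal T)$ is a map $r:V\to(0,\infty)$ such that for each tetrahedron $\{ijkh\}$ of $\mathcal T$ there is a non-degenerate hyper-ideal tetrahedron in which, for each pair of its vertices, the edge between the corresponding vertex triangles has length $l_{ij}=r_i+r_j$. Let $\beta_{ij,kh}$ be the dihedral angle of this hyper-ideal tetrahedron at the edge $\{ij\}$. The combinatorial scalar curvature of $r$ at $i\in V$ is $$K_i=\sum_{j\sim i}\Bigl(2\pi-\sum_{\{ijkh\}\in\mathcal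 T}\beta_{ij,kh}\Bigr),$$ where the outer sum is over the edges $\{ij\}$ of $\mathcal T$ at $i$ (an edge with both ends at $i$ counts twice), and the inner sum is over the edges of tetrahedra that are identified with $\{ij\}$. Then every $r\in\mathbb R_{>0}^V$ is a generalized sphere packing metric, its combinatorial scalar curvature $K(r)\in\mathbb R^V$ is well defined, and the map $r\mapsto K(r)$ is injective on $\mathbb R_{>0}^V$: a generalized sphere packing metric on $(\Sigma,\mathcal T)$ is uniquely determined by its combinatorial scalar curvature. -/

import Mathlib

open scoped Manifold

/-! ### Compact 3-manifolds with boundary and their coned-off spaces -/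

section ConedOff

variable (M : Type*) [TopologicalSpace M] [ChartedSpace (EuclideanHalfSpace 3) M]

/-- The boundary `∂M` of a topological 3-manifold with boundary, as a subspace. -/
abbrev BoundarySpace : Type _ := ↥((𝓡∂ 3).boundary M)

/-- The identifications in `M ⊔ (∂M × [0,1])` which attach the cylinder to `M` along its bottom
and collapse the top of the cylinder over each connected component of `∂M` to a point. -/
inductive ConeRel : M ⊕ (BoundarySpace M × unitInterval) →
    M ⊕ (BoundarySpace M × unitInterval) → Prop
  | base (x : BoundarySpace M) : ConeRel (Sum.inr (x, 0)) (Sum.inl (x : M))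
  | apex (x y : BoundarySpace M) (h : y ∈ connectedComponent x) :
      ConeRel (Sum.inr (x, 1)) (Sum.inr (y, 1))

/-- The space obtained from `M` by coning off each connected component of `∂M` to a point. -/
abbrev ConedOff : Type _ := Quot (ConeRel M)

/-- The cone points, one for each connected component of `∂M`. -/
def conePoints : Set (ConedOff M) :=
  {p | ∃ x : BoundarySpace M, p = Quot.mk (ConeRel M) (Sum.inr (x, 1))}

end ConedOff

/-! ### Gluings of tetrahedra -/

/-- Face pairings of a family of tetrahedra indexed by `T`. Every tetrahedron has the vertices
`0, 1, 2, 3`, and face `f` is the one opposite to vertex `f`. The face `f` of `σ` is glued to the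
face `glue σ f f` of the tetrahedron `adj σ f`, by the affine map which sends each vertex
`a ≠ f` of `σ` to the vertex `glue σ f a` of `adj σ f`. -/
structure TetGluing (T : Type*) where
  adj : T → Fin 4 → T
  glue : T → Fin 4 → Equiv.Perm (Fin 4)
  adj_adj : ∀ σ f, adj (adj σ f) (glue σ f f) = σ
  glue_glue : ∀ σ f, glue (adj σ f) (glue σ f f) = (glue σ f)⁻¹
  /-- No face is glued to itself. -/
  no_self : ∀ σ f, ¬ (adj σ f = σ ∧ glue σ f f = f)

namespace TetGluing

variable {T : Type*} (G : TetGluing T)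

/-- The identification of points on glued faces, in barycentric coordinates. -/
def PointRel (p q : Σ _ : T, stdSimplex ℝ (Fin 4)) : Prop :=
  ∃ f : Fin 4, p.2.1 f = 0 ∧ q.1 = G.adj p.1 f ∧ ∀ a, q.2.1 (G.glue p.1 f a) = p.2.1 a

/-- The space obtained by gluing the tetrahedra along their faces. -/
abbrev Realization : Type _ := Quot G.PointRel

/-- The points of the glued space which are vertices of tetrahedra. -/
def vertexPoints : Set G.Realization :=
  {p | ∃ (σ : T) (a : Fin 4), p = Quot.mk G.PointRel ⟨σ, stdSimplex.vertex a⟩}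

/-- Vertices of tetrahedra that are matched by a face pairing. -/
def VertexRel (p q : T × Fin 4) : Prop :=
  ∃ f : Fin 4, f ≠ p.2 ∧ q = (G.adj p.1 f, G.glue p.1 f p.2)

/-- The set `V` of vertices of the triangulation. -/
abbrev Vertex : Type _ := Quot G.VertexRel

/-- The vertex of the triangulation given by vertex `a` of the tetrahedron `σ`. -/
def vert (σ : T) (a : Fin 4) : G.Vertex := Quot.mk G.VertexRel (σ, a)

/-- A tetrahedron with one of its six edges, oriented: `⟨(σ, a, b), _⟩` is the edge of `σ` from
vertex `a` to vertex `b`. -/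
abbrev EdgeCorner (T : Type*) : Type _ := {c : T × Fin 4 × Fin 4 // c.2.1 ≠ c.2.2}

/-- Oriented edges of tetrahedra that are matched by a face pairing. -/
def EdgeRel (p q : EdgeCorner T) : Prop :=
  ∃ f : Fin 4, f ≠ p.1.2.1 ∧ f ≠ p.1.2.2 ∧
    q.1 = (G.adj p.1.1 f, G.glue p.1.1 f p.1.2.1, G.glue p.1.1 f p.1.2.2)

/-- The oriented edges of the triangulation. -/
abbrev OrientedEdge : Type _ := Quot G.EdgeRel

/-- The initial vertex of an oriented edge of the triangulation. -/
def start : G.OrientedEdge → G.Vertex :=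
  Quot.lift (fun c => G.vert c.1.1 c.1.2.1) (by
    rintro p q ⟨f, hf, -, hq⟩
    refine Quot.sound ⟨f, hf, ?_⟩
    rw [hq])

end TetGluing

/-- An ideal triangulation of a compact 3-manifold `M` with boundary by the tetrahedra indexed
by `T`: a triangulation of the coned-off space of `M` whose vertices are exactly the
cone points. -/
structure IdealTriangulation (M : Type*) [TopologicalSpace M]
    [ChartedSpace (EuclideanHalfSpace 3) M] (T : Type*) extends TetGluing T where
  homeo : toTetGluing.Realization ≃ₜ ConedOff M
  image_vertexPoints : homeo '' toTetGluing.vertexPoints = conePoints M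

/-! ### Hyper-ideal tetrahedra -/

/-- The Lorentzian inner product on `ℝ^{3,1}`. Hyperbolic space is
`ℍ³ = {x | lorentz x x = -1 ∧ 0 < x 3}`. -/
def lorentz (x y : Fin 4 → ℝ) : ℝ := x 0 * y 0 + x 1 * y 1 + x 2 * y 2 - x 3 * y 3

/-- The hyperbolic distance between points of the hyperboloid `ℍ³`. -/
noncomputable def hypDist (x y : Fin 4 → ℝ) : ℝ := Real.arcosh (-lorentz x y)

/-- A non-degenerate hyper-ideal tetrahedron in `ℍ³`, given by its four hyper-ideal vertices,
which are represented by linearly independent unit spacelike vectors `v₀, v₁, v₂, v₃` (in the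
projective Klein model these are the vertices of a tetrahedron, outside the closed ball).
The truncating plane dual to `vᵢ` is `Πᵢ = {x ∈ ℍ³ | lorentz x vᵢ = 0}`, and the truncated
tetrahedron is the set of the points `x ∈ ℍ³` that are combinations of the `vᵢ` with nonnegative
coefficients and satisfy `lorentz x vᵢ ≤ 0` for all `i`. Its vertex triangle `Δᵢ` lies in `Πᵢ`,
and its hexagonal face `{ijk}` lies in the plane spanned by `vᵢ, vⱼ, vₖ`. The condition
`lorentz vᵢ vⱼ < -1` says that `Πᵢ` and `Πⱼ` are disjoint with disjoint closures at infinity, and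
that the `vᵢ` are the outer normals. -/
structure HyperIdealTet where
  vertex : Fin 4 → Fin 4 → ℝ
  unit : ∀ i, lorentz (vertex i) (vertex i) = 1
  separated : ∀ i j, i ≠ j → lorentz (vertex i) (vertex j) < -1
  linearIndependent : LinearIndependent ℝ vertex
  /-- The segments between hyper-ideal vertices meet the upper sheet of the hyperboloid (their
  midpoints are timelike and future-directed). -/
  future : ∀ i j, i ≠ j → 0 < vertex i 3 + vertex j 3

namespace HyperIdealTet

variable (P : HyperIdealTet)

/-- The end point on the vertex triangle `Δᵢ` of the edge between `Δᵢ` and `Δⱼ`: the point where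
the line spanned by `vᵢ` and `vⱼ` meets the plane `Πᵢ`. -/
noncomputable def edgeEnd (i j : Fin 4) : Fin 4 → ℝ :=
  (√(lorentz (P.vertex i) (P.vertex j) ^ 2 - 1))⁻¹ •
    (P.vertex j - lorentz (P.vertex i) (P.vertex j) • P.vertex i)

/-- The length of the edge between the vertex triangles `Δᵢ` and `Δⱼ`. -/
noncomputable def edgeLength (i j : Fin 4) : ℝ := hypDist (P.edgeEnd i j) (P.edgeEnd j i)

/-- For `i`, `j`, `k` distinct, a tangent vector at the point `P.edgeEnd i j`, orthogonal to the
edge `{ij}` and pointing into the hexagonal face `{ijk}`: the component of `vₖ` orthogonal to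
`P.edgeEnd i j` and to the direction `vᵢ` of the edge at this point. -/
noncomputable def faceDir (i j k : Fin 4) : Fin 4 → ℝ :=
  P.vertex k - lorentz (P.vertex k) (P.vertex i) • P.vertex i
    + lorentz (P.vertex k) (P.edgeEnd i j) • P.edgeEnd i j

/-- For `{i, j, k, h} = {0, 1, 2, 3}`, the dihedral angle `β_{ij,kh}` at the edge `{ij}`: the angle
between the faces `{ijk}` and `{ijh}`. -/
noncomputable def dihedralAngle (i j k h : Fin 4) : ℝ :=
  Real.arccos (lorentz (P.faceDir i j k) (P.faceDir i j h) /
    (√(lorentz (P.faceDir i j k) (P.faceDir i j k)) *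
      √(lorentz (P.faceDir i j h) (P.faceDir i j h))))

end HyperIdealTet

/-- For `a ≠ b`, the smaller of the two indices other than `a`, `b`. -/
def thirdIdx (a b : Fin 4) : Fin 4 :=
  if a ≠ 0 ∧ b ≠ 0 then 0 else if a ≠ 1 ∧ b ≠ 1 then 1 else 2

/-- For `a ≠ b`, the larger of the two indices other than `a`, `b`. -/
def fourthIdx (a b : Fin 4) : Fin 4 :=
  if a ≠ 3 ∧ b ≠ 3 then 3 else if a ≠ 2 ∧ b ≠ 2 then 2 else 1

theorem thirdIdx_fourthIdx (a b : Fin 4) (h : a ≠ b) :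
    [a, b, thirdIdx a b, fourthIdx a b].Nodup := by
  revert a b
  decide

/-! ### Generalized sphere packing metrics -/

/-- A generalized sphere packing metric on a triangulation: a positive function `radius` on the
vertices, and, for each tetrahedron `σ`, a non-degenerate hyper-ideal tetrahedron with edge
lengths `l_{ij} = r_i + r_j`. (The latter is determined by `radius` up to isometry.) -/
structure SpherePackingMetric {T : Type*} (G : TetGluing T) where
  radius : G.Vertex → ℝ
  radius_pos : ∀ v, 0 < radius v
  tet : T → HyperIdealTet
  edgeLength_eq : ∀ σ a b, a ≠ b →
    (tet σ).edgeLength a b = radius (G.vert σ a) + radius (G.vert σ b)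

namespace SpherePackingMetric

variable {T : Type*} [Fintype T] {G : TetGluing T} (m : SpherePackingMetric G)

open Classical in
/-- The combinatorial Ricci curvature `K_{ij} = 2π - ∑ β_{ij,kh}` along an (oriented) edge of the
triangulation; the sum is over all edges of tetrahedra which are identified with it. -/
noncomputable def ricci (e : G.OrientedEdge) : ℝ :=
  2 * Real.pi - ∑ c : TetGluing.EdgeCorner T with Quot.mk G.EdgeRel c = e,
    (m.tet c.1.1).dihedralAngle c.1.2.1 c.1.2.2
      (thirdIdx c.1.2.1 c.1.2.2) (fourthIdx c.1.2.1 c.1.2.2)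

/-- The combinatorial scalar curvature `K_i = ∑_{j ∼ i} K_{ij}`: the sum of the Ricci curvatures of
the edges that start at the vertex `i` (multiple edges count separately, and an edge with both
ends at `i` counts once for each end). -/
noncomputable def scalarCurvature (v : G.Vertex) : ℝ :=
  ∑ᶠ e : {e : G.OrientedEdge // G.start e = v}, m.ricci e.1

end SpherePackingMetric

/-!
# Rigidity of generalized sphere packings

Write `t_i = tanh r_i` and `c_i = cosh r_i`. For the edge lengths `l_ij = r_i + r_j` the Gram matrix
of the four hyper-ideal vertices has the entries `-cosh l_ij = -c_i c_j (1 + t_i t_j)` off the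
diagonal and `1 = c_i² (1 - t_i²)` on it, so it is `C A C` with `C = diag(c)` and
`A = 2 - 1 1ᵀ - t tᵀ`. The matrix `A` has signature `(3, 1)` for all `t ∈ (0, 1)⁴`; an explicit
realization of it by Lorentzian vectors (`exists_lorentz_gram`) shows that every positive `r` is a
metric. Conversely, the edge lengths determine the Gram matrix and with it the dihedral angles
(`HyperIdealTet.dihedralAngle_eq`), whence the curvature depends on `r` only. The angle at the edge
`ij` is the `arccos` of a quotient of minors of `A`.

For injectivity, let `r`, `r'` be two metrics and `x = r' - r`. The pairing of `x` with the scalar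
curvature is a constant minus the sum, over all tetrahedra and their edges, of `(x_i + x_j) β_ij`
(`sum_mul_scalarCurvature`). It therefore suffices that on each tetrahedron this sum increases
strictly along the segment from `r` to `r'` unless `x` vanishes there (`anglePairing_lt`), i.e. that
the quadratic form `∑ (x_i + x_j) dβ_ij(x)` is positive definite. This is the statement that the
co-volume of the tetrahedron is a strictly convex function of the radii; it is proved here without
volumes. With `α_k = (t_i + t_j + t_h - t_k) / (1 + t_i t_j + t_i t_h + t_j t_h)` the angle
derivatives are linear in the `α`s up to a common factor (`hasDerivAt_packingAngle`). The mixed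
second derivatives turn out to be positive (`mixedCoeff_pos`) and each diagonal entry is at least
the sum of the others in its row (`dominance_nonneg`). Hence the form is a combination of the
squares `x_i²` with nonnegative coefficients and of the squares `(x_i + x_j)²` with positive ones
(`hessianForm_eq_sum_sq`), and it vanishes only at `0`.
-/

/-! ### Dihedral angles as functions of `tanh r`, and their derivatives -/

/-- A quarter of the negative of the `3 × 3` principal minor of the matrix `A = 2 - 1 1ᵀ - t tᵀ` on
the face whose vertices have the parameters `x`, `y`, `z`. -/
noncomputable def faceCofactor (x y z : ℝ) : ℝ := 1 + x * y + x * z + y * z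

/-- The off-diagonal analogue of `faceCofactor`: a quarter of the negative of the minor of `A` with
the rows of the face `abc` and the columns of the face `abd`. -/
noncomputable def edgeCofactor (a b c d : ℝ) : ℝ := 1 + ((a + b) * (c + d) - a ^ 2 - b ^ 2) / 2

/-- One quarter of `-det A`, where `A = 2 - 1 1ᵀ - t tᵀ` and `t = (a, b, c, d)`. When it is
positive, `A` has signature `(3, 1)`, since `A` is positive on the orthogonal complement of `1` and
`t`. -/
noncomputable def gramDisc (a b c d : ℝ) : ℝ :=
  4 + (a + b + c + d) ^ 2 - 2 * (a ^ 2 + b ^ 2 + c ^ 2 + d ^ 2)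

/-- The dihedral angle at the edge `ab` of the hyper-ideal tetrahedron whose edge lengths are sums
of vertex radii, as a function of the numbers `tanh r` at its vertices; `c` and `d` belong to the
two vertices off the edge. -/
noncomputable def packingAngle (a b c d : ℝ) : ℝ :=
  Real.arccos (edgeCofactor a b c d / (√(faceCofactor a b c) * √(faceCofactor a b d)))

/-- The quotient `α_c` in terms of which all derivatives of dihedral angles are expressed. It is
attached to the vertex `c` and symmetric in the other three variables, so `c`, in the third place,
is the distinguished one. -/
noncomputable def faceRatio (a b c d : ℝ) : ℝ := (a + b + d - c) / faceCofactor a b d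

/-- The derivative of `packingAngle a b c d` along `(a', b', c', d')`, multiplied by
`√(gramDisc a b c d)`. -/
noncomputable def angleVariation (a b c d a' b' c' d' : ℝ) : ℝ :=
  (2 - (b + d) * faceRatio a b c d / 2 - (b + c) * faceRatio a b d c / 2) * a'
    + (2 - (a + d) * faceRatio a b c d / 2 - (a + c) * faceRatio a b d c / 2) * b'
    - (a + b) * (faceRatio a b d c * c' + faceRatio a b c d * d') / 2

theorem faceCofactor_pos {x y z : ℝ} (hx : 0 < x) (hy : 0 < y) (hz : 0 < z) :
    0 < faceCofactor x y z := by
  unfold faceCofactor; positivity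

theorem gramDisc_pos {a b c d : ℝ} (ha : a ∈ Set.Ioo (0 : ℝ) 1) (hb : b ∈ Set.Ioo (0 : ℝ) 1)
    (hc : c ∈ Set.Ioo (0 : ℝ) 1) (hd : d ∈ Set.Ioo (0 : ℝ) 1) : 0 < gramDisc a b c d := by
  have h : ∀ x ∈ Set.Ioo (0 : ℝ) 1, x ^ 2 < 1 := fun x hx => by nlinarith [hx.1, hx.2]
  have h1 := mul_pos ha.1 hb.1
  have h2 := mul_pos ha.1 hc.1
  have h3 := mul_pos ha.1 hd.1
  have h4 := mul_pos hb.1 hc.1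
  have h5 := mul_pos hb.1 hd.1
  have h6 := mul_pos hc.1 hd.1
  unfold gramDisc
  linarith [h a ha, h b hb, h c hc, h d hd]

/-- Jacobi's identity for complementary minors of `A`. It makes the sine of the dihedral angle at
the edge `ab` equal to `√(gramDisc a b c d) * (a + b) / 2`, divided by the square root of the
product of the two face cofactors, so that the angle derivatives involve only one irrationality,
common to all six edges. -/
theorem faceCofactor_mul_sub_sq (a b c d : ℝ) :
    faceCofactor a b c * faceCofactor a b d - edgeCofactor a b c d ^ 2 =
      gramDisc a b c d * ((a + b) / 2) ^ 2 := by
  unfold faceCofactor edgeCofactor gramDisc; ring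

theorem HasDerivAt.arccos_div_sqrt_mul_sqrt {f g h : ℝ → ℝ} {f' g' h' s w : ℝ}
    (hf : HasDerivAt f f' s) (hg : HasDerivAt g g' s) (hh : HasDerivAt h h' s)
    (hg0 : 0 < g s) (hh0 : 0 < h s) (hw : 0 < w) (hdet : g s * h s - f s ^ 2 = w ^ 2) :
    HasDerivAt (fun x => Real.arccos (f x / (√(g x) * √(h x))))
      (-(f' - f s * (g' / g s + h' / h s) / 2) / w) s := by
  have hG : 0 < √(g s) := Real.sqrt_pos.2 hg0
  have hH : 0 < √(h s) := Real.sqrt_pos.2 hh0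
  have hG2 : √(g s) ^ 2 = g s := Real.sq_sqrt hg0.le
  have hH2 : √(h s) ^ 2 = h s := Real.sq_sqrt hh0.le
  have hgh : 0 < √(g s) * √(h s) := mul_pos hG hH
  have hu : 1 - (f s / (√(g s) * √(h s))) ^ 2 = (w / (√(g s) * √(h s))) ^ 2 := by
    field_simp
    rw [hG2, hH2]; linarith
  have hpos : 0 < (w / (√(g s) * √(h s))) ^ 2 := by positivity
  have hne1 : f s / (√(g s) * √(h s)) ≠ -1 := by
    intro h0; rw [h0] at hu; norm_num at hu; exact hpos.ne hu
  have hne2 : f s / (√(g s) * √(h s)) ≠ 1 := by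
    intro h0; rw [h0] at hu; norm_num at hu; exact hpos.ne hu
  have hd := (Real.hasDerivAt_arccos hne1 hne2).comp s
    (hf.div ((hg.sqrt hg0.ne').mul (hh.sqrt hh0.ne')) hgh.ne')
  refine hd.congr_deriv ?_
  rw [hu, Real.sqrt_sq (by positivity)]
  simp only [Pi.mul_apply]
  have e1 : g' / g s = g' / √(g s) ^ 2 := by rw [hG2]
  have e2 : h' / h s = h' / √(h s) ^ 2 := by rw [hH2]
  rw [e1, e2]
  field_simp

theorem hasDerivAt_packingAngle {a b c d : ℝ → ℝ} {a' b' c' d' s : ℝ}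
    (ha : HasDerivAt a a' s) (hb : HasDerivAt b b' s) (hc : HasDerivAt c c' s)
    (hd : HasDerivAt d d' s)
    (ha1 : a s ∈ Set.Ioo (0 : ℝ) 1) (hb1 : b s ∈ Set.Ioo (0 : ℝ) 1)
    (hc1 : c s ∈ Set.Ioo (0 : ℝ) 1) (hd1 : d s ∈ Set.Ioo (0 : ℝ) 1) :
    HasDerivAt (fun x => packingAngle (a x) (b x) (c x) (d x))
      (angleVariation (a s) (b s) (c s) (d s) a' b' c' d' / √(gramDisc (a s) (b s) (c s) (d s)))
      s := by
  have hD := gramDisc_pos ha1 hb1 hc1 hd1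
  have hc0 := faceCofactor_pos ha1.1 hb1.1 hc1.1
  have hd0 := faceCofactor_pos ha1.1 hb1.1 hd1.1
  have hab : 0 < a s + b s := add_pos ha1.1 hb1.1
  have hf : HasDerivAt (fun x => edgeCofactor (a x) (b x) (c x) (d x))
      (((a' + b') * (c s + d s) + (a s + b s) * (c' + d') - 2 * a s * a' - 2 * b s * b') / 2)
      s := by
    unfold edgeCofactor
    refine (((((ha.add hb).mul (hc.add hd)).sub (ha.pow 2)).sub (hb.pow 2)).div_const 2
      |>.const_add 1).congr_deriv ?_
    simp
  have hF : ∀ {e : ℝ → ℝ} {e' : ℝ}, HasDerivAt e e' s →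
      HasDerivAt (fun x => faceCofactor (a x) (b x) (e x))
        (a' * b s + a s * b' + (a' * e s + a s * e') + (b' * e s + b s * e')) s := by
    intro e e' he
    unfold faceCofactor
    exact (((ha.mul hb).const_add 1).add (ha.mul he)).add (hb.mul he)
  have hw : 0 < √(gramDisc (a s) (b s) (c s) (d s)) * ((a s + b s) / 2) := by positivity
  refine (hf.arccos_div_sqrt_mul_sqrt (hF hc) (hF hd) hc0 hd0 hw ?_).congr_deriv ?_
  · rw [faceCofactor_mul_sub_sq, mul_pow, Real.sq_sqrt hD.le]
  · have hS : 0 < √(gramDisc (a s) (b s) (c s) (d s)) := Real.sqrt_pos.2 hD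
    generalize √(gramDisc (a s) (b s) (c s) (d s)) = S at *
    rw [div_eq_div_iff (by positivity) hS.ne']
    unfold angleVariation faceRatio
    unfold edgeCofactor
    field_simp
    unfold faceCofactor
    ring

/-! ### Positivity of the Hessian -/

/-- The coefficient `μ_ab` of the Hessian for two different vertices, up to the positive factor
`(1 - a²) (1 - b²) / √(gramDisc a b c d)`. -/
noncomputable def mixedCoeff (a b c d : ℝ) : ℝ :=
  (2 * (1 + a * b) + (a + b) * (c + d) - (c - d) ^ 2) / (faceCofactor a b c * faceCofactor a b d)

theorem mixedCoeff_pos {a b c d : ℝ} (ha : a ∈ Set.Ioo (0 : ℝ) 1) (hb : b ∈ Set.Ioo (0 : ℝ) 1)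
    (hc : c ∈ Set.Ioo (0 : ℝ) 1) (hd : d ∈ Set.Ioo (0 : ℝ) 1) : 0 < mixedCoeff a b c d := by
  have hab := mul_pos ha.1 hb.1
  have habcd := mul_pos (add_pos ha.1 hb.1) (add_pos hc.1 hd.1)
  have : (c - d) ^ 2 < 1 := by nlinarith [hc.1, hc.2, hd.1, hd.2]
  refine div_pos (by linarith) (mul_pos (faceCofactor_pos ha.1 hb.1 hc.1)
    (faceCofactor_pos ha.1 hb.1 hd.1))

/-- The derivative of the sum of the three dihedral angles at the vertex `a` with respect to the
parameter `b`, up to the factor of `angleVariation`. -/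
theorem mixedCoeff_eq {a b c d : ℝ} (ha : 0 < a) (hb : 0 < b) (hc : 0 < c) (hd : 0 < d) :
    2 - (a + d) * faceRatio a b c d - (a + c) * faceRatio a b d c =
      (1 - a ^ 2) * mixedCoeff a b c d := by
  have h1 := (faceCofactor_pos ha hb hc).ne'
  have h2 := (faceCofactor_pos ha hb hd).ne'
  unfold faceRatio mixedCoeff
  field_simp
  unfold faceCofactor
  ring

/-- Diagonal dominance of the Hessian: up to a common positive factor, the diagonal entry at the
vertex `a` is at least the sum of the three other entries of its row. -/
theorem dominance_nonneg {a b c d : ℝ} (ha : 0 < a) (hb : 0 < b) (hc : 0 < c) (hd : 0 < d) :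
    0 ≤ 6 - (c + d) * faceRatio a c b d - (b + d) * faceRatio a b c d
        - (b + c) * faceRatio a b d c
      - (1 - b ^ 2) * mixedCoeff a b c d - (1 - c ^ 2) * mixedCoeff a c b d
      - (1 - d ^ 2) * mixedCoeff a d b c := by
  have h1 := faceCofactor_pos ha hb hc
  have h2 := faceCofactor_pos ha hb hd
  have h3 := faceCofactor_pos ha hc hd
  have key : 6 - (c + d) * faceRatio a c b d - (b + d) * faceRatio a b c d
        - (b + c) * faceRatio a b d c
      - (1 - b ^ 2) * mixedCoeff a b c d - (1 - c ^ 2) * mixedCoeff a c b d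
      - (1 - d ^ 2) * mixedCoeff a d b c =
      (b * c * (b - c) ^ 2 + b * d * (b - d) ^ 2 + c * d * (c - d) ^ 2 + (
      2 * d ^ 2 + 2 * c ^ 2 + 4 * b * c * d ^ 2 + 4 * b * c ^ 2 * d + 2 * b ^ 2 + 4 * b ^
      2 * c * d + 6 * b ^ 2 * c ^ 2 * d ^ 2 + 2 * a * d + 2 * a * d ^ 3 + 2 * a * c + 3 *
      a * c * d ^ 2 + 3 * a * c ^ 2 * d + 2 * a * c ^ 3 + 2 * a * b + 3 * a * b * d ^ 2 +
      12 * a * b * c * d + 2 * a * b * c * d ^ 3 + 3 * a * b * c ^ 2 + 8 * a * b * c ^ 2 *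
      d ^ 2 + 2 * a * b * c ^ 3 * d + 3 * a * b ^ 2 * d + 3 * a * b ^ 2 * c + 8 * a * b ^
      2 * c * d ^ 2 + 8 * a * b ^ 2 * c ^ 2 * d + 2 * a * b ^ 3 + 2 * a * b ^ 3 * c * d +
      2 * a ^ 2 * d ^ 2 + 6 * a ^ 2 * c * d + a ^ 2 * c * d ^ 3 + 2 * a ^ 2 * c ^ 2 + 4 *
      a ^ 2 * c ^ 2 * d ^ 2 + a ^ 2 * c ^ 3 * d + 6 * a ^ 2 * b * d + a ^ 2 * b * d ^ 3 +
      6 * a ^ 2 * b * c + 10 * a ^ 2 * b * c * d ^ 2 + 10 * a ^ 2 * b * c ^ 2 * d + a ^ 2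
      * b * c ^ 3 + 2 * a ^ 2 * b ^ 2 + 4 * a ^ 2 * b ^ 2 * d ^ 2 + 10 * a ^ 2 * b ^ 2 * c
      * d + 4 * a ^ 2 * b ^ 2 * c ^ 2 + a ^ 2 * b ^ 3 * d + a ^ 2 * b ^ 3 * c + 3 * a ^ 3
      * c * d ^ 2 + 3 * a ^ 3 * c ^ 2 * d + 3 * a ^ 3 * b * d ^ 2 + 6 * a ^ 3 * b * c * d
      + 3 * a ^ 3 * b * c ^ 2 + 3 * a ^ 3 * b ^ 2 * d + 3 * a ^ 3 * b ^ 2 * c)) /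
      (faceCofactor a b c * faceCofactor a b d * faceCofactor a c d) := by
    have e1 : faceCofactor a c b = faceCofactor a b c := by unfold faceCofactor; ring
    have e2 : faceCofactor a d b = faceCofactor a b d := by unfold faceCofactor; ring
    have e3 : faceCofactor a d c = faceCofactor a c d := by unfold faceCofactor; ring
    unfold faceRatio mixedCoeff
    rw [e1, e2, e3]
    field_simp
    unfold faceCofactor
    ring
  -- In the expanded numerator the only negative monomials are `-2b²c²`, `-2b²d²` and `-2c²d²`;
  -- they are absorbed in the three squares.
  rw [key]
  positivity

theorem faceCofactor_swap_left (x y z : ℝ) : faceCofactor x y z = faceCofactor y x z := by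
  unfold faceCofactor; ring

theorem edgeCofactor_swap_left (a b c d : ℝ) : edgeCofactor a b c d = edgeCofactor b a c d := by
  unfold edgeCofactor; ring

theorem packingAngle_swap_left (a b c d : ℝ) : packingAngle a b c d = packingAngle b a c d := by
  unfold packingAngle
  rw [edgeCofactor_swap_left, faceCofactor_swap_left a b c, faceCofactor_swap_left a b d]

theorem faceRatio_swap_left (a b c d : ℝ) : faceRatio a b c d = faceRatio b a c d := by
  unfold faceRatio faceCofactor; ring

theorem faceRatio_swap_right (a b c d : ℝ) : faceRatio a b c d = faceRatio a d c b := by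
  unfold faceRatio faceCofactor; ring

theorem mixedCoeff_swap_left (a b c d : ℝ) : mixedCoeff a b c d = mixedCoeff b a c d := by
  unfold mixedCoeff faceCofactor; ring

/-- The quadratic form `∑ (x_a + x_b) dβ_ab`, over the six edges, up to the factor
`1 / √(gramDisc a b c d)`, for the variation `(x, y, z, w)` of the radii. A variation `x` of
the radius changes the parameter `a = tanh r` by `(1 - a²) x`. -/
noncomputable def hessianForm (a b c d x y z w : ℝ) : ℝ :=
  let V (p q r s x y z w : ℝ) : ℝ := angleVariation p q r s
    ((1 - p ^ 2) * x) ((1 - q ^ 2) * y) ((1 - r ^ 2) * z) ((1 - s ^ 2) * w)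
  (x + y) * V a b c d x y z w + (x + z) * V a c b d x z y w + (x + w) * V a d b c x w y z
    + (y + z) * V b c a d y z x w + (y + w) * V b d a c y w x z + (z + w) * V c d a b z w x y

set_option maxHeartbeats 1000000 in
theorem hessianForm_eq_sum_sq {a b c d : ℝ} (ha : 0 < a) (hb : 0 < b) (hc : 0 < c) (hd : 0 < d)
    (x y z w : ℝ) : hessianForm a b c d x y z w =
      (1 - a ^ 2) * (6 - (c + d) * faceRatio a c b d - (b + d) * faceRatio a b c d
        - (b + c) * faceRatio a b d c
        - (1 - b ^ 2) * mixedCoeff a b c d - (1 - c ^ 2) * mixedCoeff a c b d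
        - (1 - d ^ 2) * mixedCoeff a d b c) * x ^ 2
      + (1 - b ^ 2) * (6 - (c + d) * faceRatio b c a d - (a + d) * faceRatio b a c d
        - (a + c) * faceRatio b a d c
        - (1 - a ^ 2) * mixedCoeff b a c d - (1 - c ^ 2) * mixedCoeff b c a d
        - (1 - d ^ 2) * mixedCoeff b d a c) * y ^ 2
      + (1 - c ^ 2) * (6 - (b + d) * faceRatio c b a d - (a + d) * faceRatio c a b d
        - (a + b) * faceRatio c a d b
        - (1 - a ^ 2) * mixedCoeff c a b d - (1 - b ^ 2) * mixedCoeff c b a d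
        - (1 - d ^ 2) * mixedCoeff c d a b) * z ^ 2
      + (1 - d ^ 2) * (6 - (b + c) * faceRatio d b a c - (a + c) * faceRatio d a b c
        - (a + b) * faceRatio d a c b
        - (1 - a ^ 2) * mixedCoeff d a b c - (1 - b ^ 2) * mixedCoeff d b a c
        - (1 - c ^ 2) * mixedCoeff d c a b) * w ^ 2
      + (1 - a ^ 2) * (1 - b ^ 2) * mixedCoeff a b c d * (x + y) ^ 2
      + (1 - a ^ 2) * (1 - c ^ 2) * mixedCoeff a c b d * (x + z) ^ 2
      + (1 - a ^ 2) * (1 - d ^ 2) * mixedCoeff a d b c * (x + w) ^ 2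
      + (1 - b ^ 2) * (1 - c ^ 2) * mixedCoeff b c a d * (y + z) ^ 2
      + (1 - b ^ 2) * (1 - d ^ 2) * mixedCoeff b d a c * (y + w) ^ 2
      + (1 - c ^ 2) * (1 - d ^ 2) * mixedCoeff c d a b * (z + w) ^ 2 := by
  have Mab := mixedCoeff_eq ha hb hc hd
  have Mba := mixedCoeff_eq hb ha hc hd
  have Mac := mixedCoeff_eq ha hc hb hd
  have Mca := mixedCoeff_eq hc ha hb hd
  have Mad := mixedCoeff_eq ha hd hb hc
  have Mda := mixedCoeff_eq hd ha hb hc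
  have Mbc := mixedCoeff_eq hb hc ha hd
  have Mcb := mixedCoeff_eq hc hb ha hd
  have Mbd := mixedCoeff_eq hb hd ha hc
  have Mdb := mixedCoeff_eq hd hb ha hc
  have Mcd := mixedCoeff_eq hc hd ha hb
  have Mdc := mixedCoeff_eq hd hc ha hb
  unfold hessianForm angleVariation
  simp only [faceRatio_swap_left, faceRatio_swap_right, mixedCoeff_swap_left]
    at Mab Mba Mac Mca Mad Mda Mbc Mcb Mbd Mdb Mcd Mdc ⊢
  linear_combination (1 - b ^ 2) * x * y * Mab + (1 - a ^ 2) * x * y * Mba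
    + (1 - c ^ 2) * x * z * Mac + (1 - a ^ 2) * x * z * Mca
    + (1 - d ^ 2) * x * w * Mad + (1 - a ^ 2) * x * w * Mda
    + (1 - c ^ 2) * y * z * Mbc + (1 - b ^ 2) * y * z * Mcb
    + (1 - d ^ 2) * y * w * Mbd + (1 - b ^ 2) * y * w * Mdb
    + (1 - d ^ 2) * z * w * Mcd + (1 - c ^ 2) * z * w * Mdc

theorem hessianForm_pos {a b c d x y z w : ℝ} (ha : a ∈ Set.Ioo (0 : ℝ) 1)
    (hb : b ∈ Set.Ioo (0 : ℝ) 1) (hc : c ∈ Set.Ioo (0 : ℝ) 1) (hd : d ∈ Set.Ioo (0 : ℝ) 1)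
    (h : x ≠ 0 ∨ y ≠ 0 ∨ z ≠ 0 ∨ w ≠ 0) : 0 < hessianForm a b c d x y z w := by
  have Da := dominance_nonneg ha.1 hb.1 hc.1 hd.1
  have Db := dominance_nonneg hb.1 ha.1 hc.1 hd.1
  have Dc := dominance_nonneg hc.1 ha.1 hb.1 hd.1
  have Dd := dominance_nonneg hd.1 ha.1 hb.1 hc.1
  have Pab := mixedCoeff_pos ha hb hc hd
  have Pac := mixedCoeff_pos ha hc hb hd
  have Pad := mixedCoeff_pos ha hd hb hc
  have Pbc := mixedCoeff_pos hb hc ha hd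
  have Pbd := mixedCoeff_pos hb hd ha hc
  have Pcd := mixedCoeff_pos hc hd ha hb
  have S : ∀ p ∈ Set.Ioo (0 : ℝ) 1, 0 < 1 - p ^ 2 := fun p hp => by nlinarith [hp.1, hp.2]
  have Sa := S a ha
  have Sb := S b hb
  have Sc := S c hc
  have Sd := S d hd
  rw [hessianForm_eq_sum_sq ha.1 hb.1 hc.1 hd.1]
  have Ha := mul_nonneg (mul_nonneg Sa.le Da) (sq_nonneg x)
  have Hb := mul_nonneg (mul_nonneg Sb.le Db) (sq_nonneg y)
  have Hc := mul_nonneg (mul_nonneg Sc.le Dc) (sq_nonneg z)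
  have Hd := mul_nonneg (mul_nonneg Sd.le Dd) (sq_nonneg w)
  have Qab := mul_pos (mul_pos Sa Sb) Pab
  have Qac := mul_pos (mul_pos Sa Sc) Pac
  have Qad := mul_pos (mul_pos Sa Sd) Pad
  have Qbc := mul_pos (mul_pos Sb Sc) Pbc
  have Qbd := mul_pos (mul_pos Sb Sd) Pbd
  have Qcd := mul_pos (mul_pos Sc Sd) Pcd
  have Hab := mul_nonneg Qab.le (sq_nonneg (x + y))
  have Hac := mul_nonneg Qac.le (sq_nonneg (x + z))
  have Had := mul_nonneg Qad.le (sq_nonneg (x + w))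
  have Hbc := mul_nonneg Qbc.le (sq_nonneg (y + z))
  have Hbd := mul_nonneg Qbd.le (sq_nonneg (y + w))
  have Hcd := mul_nonneg Qcd.le (sq_nonneg (z + w))
  by_contra hle
  have eq_zero : ∀ {q u : ℝ}, 0 < q → q * u ^ 2 ≤ 0 → u = 0 := fun {q u} hq hu =>
    pow_eq_zero_iff two_ne_zero |>.1 (le_antisymm (nonpos_of_mul_nonpos_right hu hq) (sq_nonneg u))
  have hxy := eq_zero (u := x + y) Qab (by linarith)
  have hxz := eq_zero (u := x + z) Qac (by linarith)
  have hxw := eq_zero (u := x + w) Qad (by linarith)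
  -- Three of the radii have pairwise opposite variations, so all variations vanish.
  have hyz := eq_zero (u := y + z) Qbc (by linarith)
  rcases h with h | h | h | h <;> exact h (by linarith)

/-! ### Monotonicity of the angle sums of a tetrahedron -/

/-- The dihedral angle at the edge `{a, b}` as a function of the four radii. -/
noncomputable def edgeAngle (r : Fin 4 → ℝ) (a b : Fin 4) : ℝ :=
  packingAngle (Real.tanh (r a)) (Real.tanh (r b)) (Real.tanh (r (thirdIdx a b)))
    (Real.tanh (r (fourthIdx a b)))

theorem tanh_mem_Ioo {x : ℝ} (hx : 0 < x) : Real.tanh x ∈ Set.Ioo (0 : ℝ) 1 := by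
  rw [Real.tanh_eq_sinh_div_cosh]
  have h := Real.sinh_pos_iff.2 hx
  refine ⟨div_pos h (Real.cosh_pos x), (div_lt_one (Real.cosh_pos x)).2 (Real.sinh_lt_cosh x)⟩

theorem edgeAngle_comm (r : Fin 4 → ℝ) (a b : Fin 4) : edgeAngle r a b = edgeAngle r b a := by
  have h : ∀ a b, thirdIdx a b = thirdIdx b a ∧ fourthIdx a b = fourthIdx b a := by decide
  unfold edgeAngle
  rw [(h a b).1, (h a b).2, packingAngle_swap_left]

/-- The sum over the six edges of `x_a + x_b` times the dihedral angle: the pairing of `x` with the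
vector of the sums of the three dihedral angles at each vertex. -/
noncomputable def anglePairing (x r : Fin 4 → ℝ) : ℝ :=
  (x 0 + x 1) * edgeAngle r 0 1 + (x 0 + x 2) * edgeAngle r 0 2 + (x 0 + x 3) * edgeAngle r 0 3
    + (x 1 + x 2) * edgeAngle r 1 2 + (x 1 + x 3) * edgeAngle r 1 3 + (x 2 + x 3) * edgeAngle r 2 3

theorem anglePairing_eq_sum (x r : Fin 4 → ℝ) :
    anglePairing x r = ∑ a, ∑ b, if a ≠ b then x a * edgeAngle r a b else 0 := by
  simp only [Fin.sum_univ_four, anglePairing]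
  rw [edgeAngle_comm r 1 0, edgeAngle_comm r 2 0, edgeAngle_comm r 3 0, edgeAngle_comm r 2 1,
    edgeAngle_comm r 3 1, edgeAngle_comm r 3 2]
  simp
  ring

theorem hasDerivAt_tanh (x : ℝ) : HasDerivAt Real.tanh (1 - Real.tanh x ^ 2) x := by
  have hc := (Real.cosh_pos x).ne'
  have h := (Real.hasDerivAt_sinh x).div (Real.hasDerivAt_cosh x) hc
  have e : Real.tanh = Real.sinh / Real.cosh := by
    ext y; exact Real.tanh_eq_sinh_div_cosh y
  rw [e]
  refine h.congr_deriv ?_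
  simp only [Pi.div_apply]
  field_simp

theorem hasDerivAt_anglePairing {r x : Fin 4 → ℝ} {s : ℝ} (hr : ∀ a, 0 < r a + s * x a) :
    HasDerivAt (fun s => anglePairing x (fun a => r a + s * x a))
      (let t a := Real.tanh (r a + s * x a)
       hessianForm (t 0) (t 1) (t 2) (t 3) (x 0) (x 1) (x 2) (x 3) /
        √(gramDisc (t 0) (t 1) (t 2) (t 3))) s := by
  have ht : ∀ a, HasDerivAt (fun s => Real.tanh (r a + s * x a))
      ((1 - Real.tanh (r a + s * x a) ^ 2) * x a) s := by
    intro a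
    have h1 : HasDerivAt (fun s => r a + s * x a) (x a) s := by
      simpa using ((hasDerivAt_id s).mul_const (x a)).const_add (r a)
    exact (hasDerivAt_tanh _).comp s h1
  have hm : ∀ a, Real.tanh (r a + s * x a) ∈ Set.Ioo (0 : ℝ) 1 := fun a => tanh_mem_Ioo (hr a)
  have he : ∀ a b, HasDerivAt (fun s => edgeAngle (fun a => r a + s * x a) a b) _ s := fun a b =>
    hasDerivAt_packingAngle (ht a) (ht b) (ht (thirdIdx a b)) (ht (fourthIdx a b)) (hm _) (hm _)
      (hm _) (hm _)
  unfold anglePairing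
  refine (((((((he 0 1).const_mul (x 0 + x 1)).add ((he 0 2).const_mul (x 0 + x 2))).add
    ((he 0 3).const_mul (x 0 + x 3))).add ((he 1 2).const_mul (x 1 + x 2))).add
    ((he 1 3).const_mul (x 1 + x 3))).add ((he 2 3).const_mul (x 2 + x 3))).congr_deriv ?_
  simp only [show thirdIdx 0 1 = 2 from rfl, show fourthIdx 0 1 = 3 from rfl,
    show thirdIdx 0 2 = 1 from rfl, show fourthIdx 0 2 = 3 from rfl,
    show thirdIdx 0 3 = 1 from rfl, show fourthIdx 0 3 = 2 from rfl,
    show thirdIdx 1 2 = 0 from rfl, show fourthIdx 1 2 = 3 from rfl,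
    show thirdIdx 1 3 = 0 from rfl, show fourthIdx 1 3 = 2 from rfl,
    show thirdIdx 2 3 = 0 from rfl, show fourthIdx 2 3 = 1 from rfl]
  generalize Real.tanh (r 0 + s * x 0) = a
  generalize Real.tanh (r 1 + s * x 1) = b
  generalize Real.tanh (r 2 + s * x 2) = c
  generalize Real.tanh (r 3 + s * x 3) = d
  have e1 : gramDisc a c b d = gramDisc a b c d := by unfold gramDisc; ring
  have e2 : gramDisc a d b c = gramDisc a b c d := by unfold gramDisc; ring
  have e3 : gramDisc b c a d = gramDisc a b c d := by unfold gramDisc; ring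
  have e4 : gramDisc b d a c = gramDisc a b c d := by unfold gramDisc; ring
  have e5 : gramDisc c d a b = gramDisc a b c d := by unfold gramDisc; ring
  rw [e1, e2, e3, e4, e5]
  unfold hessianForm
  ring

/-- Strict monotonicity, on one tetrahedron, of the map which sends the radii to the sums of the
dihedral angles at the vertices. -/
theorem anglePairing_lt {r₁ r₂ : Fin 4 → ℝ} (h₁ : ∀ a, 0 < r₁ a) (h₂ : ∀ a, 0 < r₂ a)
    (hne : r₁ ≠ r₂) : anglePairing (r₂ - r₁) r₁ < anglePairing (r₂ - r₁) r₂ := by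
  set x := r₂ - r₁ with hx
  have hpos : ∀ s ∈ Set.Icc (0 : ℝ) 1, ∀ a, 0 < r₁ a + s * x a := by
    intro s hs a
    have : r₁ a + s * x a = (1 - s) * r₁ a + s * r₂ a := by simp [hx]; ring
    rw [this]
    rcases hs.1.eq_or_lt with rfl | h0
    · simpa using h₁ a
    · exact add_pos_of_nonneg_of_pos (mul_nonneg (sub_nonneg.2 hs.2) (h₁ a).le)
        (mul_pos h0 (h₂ a))
  have hmono : StrictMonoOn (fun s : ℝ => anglePairing x (fun a => r₁ a + s * x a))
      (Set.Icc 0 1) := by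
    refine strictMonoOn_of_deriv_pos (convex_Icc 0 1)
      (fun s hs => (hasDerivAt_anglePairing (hpos s hs)).continuousAt.continuousWithinAt) ?_
    intro s hs
    have hs := hpos s (interior_subset hs)
    rw [(hasDerivAt_anglePairing hs).deriv]
    have hm : ∀ a, Real.tanh (r₁ a + s * x a) ∈ Set.Ioo (0 : ℝ) 1 := fun a => tanh_mem_Ioo (hs a)
    refine div_pos (hessianForm_pos (hm 0) (hm 1) (hm 2) (hm 3) ?_)
      (Real.sqrt_pos.2 (gramDisc_pos (hm 0) (hm 1) (hm 2) (hm 3)))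
    by_contra! h0
    apply hne
    have : x = 0 := by ext a; fin_cases a <;> simp [h0]
    exact (sub_eq_zero.1 this).symm
  have := hmono (Set.left_mem_Icc.2 zero_le_one) (Set.right_mem_Icc.2 zero_le_one) zero_lt_one
  simpa [hx] using this

/-! ### Dihedral angles of hyper-ideal tetrahedra -/

theorem lorentz_comm (x y : Fin 4 → ℝ) : lorentz x y = lorentz y x := by
  unfold lorentz; ring

theorem lorentz_add_left (x y z : Fin 4 → ℝ) : lorentz (x + y) z = lorentz x z + lorentz y z := by
  simp only [lorentz, Pi.add_apply]; ring

theorem lorentz_sub_left (x y z : Fin 4 → ℝ) : lorentz (x - y) z = lorentz x z - lorentz y z := by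
  simp only [lorentz, Pi.sub_apply]; ring

theorem lorentz_smul_left (k : ℝ) (x z : Fin 4 → ℝ) : lorentz (k • x) z = k * lorentz x z := by
  simp only [lorentz, Pi.smul_apply, smul_eq_mul]; ring

theorem lorentz_add_right (x y z : Fin 4 → ℝ) : lorentz z (x + y) = lorentz z x + lorentz z y := by
  simp only [lorentz, Pi.add_apply]; ring

theorem lorentz_sub_right (x y z : Fin 4 → ℝ) : lorentz z (x - y) = lorentz z x - lorentz z y := by
  simp only [lorentz, Pi.sub_apply]; ring

theorem lorentz_smul_right (k : ℝ) (x z : Fin 4 → ℝ) : lorentz z (k • x) = k * lorentz z x := by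
  simp only [lorentz, Pi.smul_apply, smul_eq_mul]; ring

theorem neg_cosh_add_eq (x y : ℝ) : -Real.cosh (x + y) =
    -(Real.cosh x * Real.cosh y * (1 + Real.tanh x * Real.tanh y)) := by
  have h1 := (Real.cosh_pos x).ne'
  have h2 := (Real.cosh_pos y).ne'
  rw [Real.cosh_add, Real.tanh_eq_sinh_div_cosh, Real.tanh_eq_sinh_div_cosh]
  field_simp

/-- The Schur complement, with respect to an edge, of the Gram matrix of a sphere packing. Here `A`,
`B`, `K`, `L` are the hyperbolic cosines of four radii and `a`, `b`, `k`, `l` their hyperbolic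
tangents. The entry `g` is arbitrary in order to cover the diagonal entries as well. -/
theorem schur_complement_packingGram {A B K L a b k l : ℝ} (hA : A ^ 2 * (1 - a ^ 2) = 1)
    (hB : B ^ 2 * (1 - b ^ 2) = 1) (hab : a + b ≠ 0) (g : ℝ) :
    g - -(K * A * (1 + k * a)) * -(L * A * (1 + l * a))
      + (-(K * B * (1 + k * b)) - -(A * B * (1 + a * b)) * -(K * A * (1 + k * a)))
        * (-(L * B * (1 + l * b)) - -(A * B * (1 + a * b)) * -(L * A * (1 + l * a)))
        / ((-(A * B * (1 + a * b))) ^ 2 - 1) =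
      g + K * L * (1 + k * l)
        + 2 * K / (a + b) * (2 * L / (a + b)) * edgeCofactor a b k l := by
  have hA0 : A ≠ 0 := by rintro rfl; simp at hA
  have hB0 : B ≠ 0 := by rintro rfl; simp at hB
  have ha0 : 1 - a ^ 2 ≠ 0 := by intro h; simp [h] at hA
  -- `1` is written as `A² (1 - a²) B² (1 - b²)` here and as `A² (1 - a²)` in `hnum`.
  have hden : (-(A * B * (1 + a * b))) ^ 2 - 1 = (A * B * (a + b)) ^ 2 := by
    linear_combination (1 - b ^ 2) * B ^ 2 * hA + hB
  have hnum : ∀ K k : ℝ, -(K * B * (1 + k * b)) - -(A * B * (1 + a * b)) * -(K * A * (1 + k * a)) =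
      -(K * B * A ^ 2 * (2 + k * (a + b) + a * (b - a))) := by
    intro K k
    linear_combination K * B * (1 + k * b) * hA
  have hfrac : (-(K * B * A ^ 2 * (2 + k * (a + b) + a * (b - a)))
      * -(L * B * A ^ 2 * (2 + l * (a + b) + a * (b - a)))) / (A * B * (a + b)) ^ 2 =
      K * L * A ^ 2 * ((2 + k * (a + b) + a * (b - a)) * (2 + l * (a + b) + a * (b - a)))
        / (a + b) ^ 2 := by
    field_simp
  have hA2 : A ^ 2 = 1 / (1 - a ^ 2) := by rw [eq_div_iff ha0, hA]
  have hKL : -(K * A * (1 + k * a)) * -(L * A * (1 + l * a)) =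
      K * L * A ^ 2 * ((1 + k * a) * (1 + l * a)) := by ring
  rw [hden, hnum, hnum, hfrac, hKL, hA2]
  unfold edgeCofactor
  field_simp
  ring

namespace HyperIdealTet

variable (P : HyperIdealTet)

theorem edgeLength_eq_arcosh {i j : Fin 4} (h : i ≠ j) :
    P.edgeLength i j = Real.arcosh (-lorentz (P.vertex i) (P.vertex j)) := by
  have hs := P.separated i j h
  have hp : 0 < lorentz (P.vertex i) (P.vertex j) ^ 2 - 1 := by nlinarith
  have hsq := Real.sq_sqrt hp.le
  have hne := (Real.sqrt_pos.2 hp).ne'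
  unfold edgeLength hypDist edgeEnd
  simp only [lorentz_smul_left, lorentz_smul_right, lorentz_sub_left, lorentz_sub_right, P.unit]
  rw [lorentz_comm (P.vertex j) (P.vertex i)]
  generalize lorentz (P.vertex i) (P.vertex j) = g at *
  generalize √(g ^ 2 - 1) = S at *
  congr 2
  field_simp
  rw [hsq]
  ring

theorem lorentz_vertex_eq_neg_cosh {i j : Fin 4} (h : i ≠ j) :
    lorentz (P.vertex i) (P.vertex j) = -Real.cosh (P.edgeLength i j) := by
  rw [P.edgeLength_eq_arcosh h, Real.cosh_arcosh (by linarith [P.separated i j h])]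
  ring

theorem lorentz_faceDir {i j : Fin 4} (h : i ≠ j) (k l : Fin 4) :
    lorentz (P.faceDir i j k) (P.faceDir i j l) =
      lorentz (P.vertex k) (P.vertex l)
        - lorentz (P.vertex k) (P.vertex i) * lorentz (P.vertex l) (P.vertex i)
        + (lorentz (P.vertex k) (P.vertex j)
            - lorentz (P.vertex i) (P.vertex j) * lorentz (P.vertex k) (P.vertex i))
          * (lorentz (P.vertex l) (P.vertex j)
            - lorentz (P.vertex i) (P.vertex j) * lorentz (P.vertex l) (P.vertex i))
          / (lorentz (P.vertex i) (P.vertex j) ^ 2 - 1) := by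
  have hs := P.separated i j h
  have hp : 0 < lorentz (P.vertex i) (P.vertex j) ^ 2 - 1 := by nlinarith
  have hsq := Real.sq_sqrt hp.le
  have hne := (Real.sqrt_pos.2 hp).ne'
  unfold faceDir edgeEnd
  simp only [lorentz_smul_left, lorentz_smul_right, lorentz_sub_left, lorentz_sub_right, P.unit,
    lorentz_add_left, lorentz_add_right]
  rw [lorentz_comm (P.vertex j) (P.vertex i), lorentz_comm (P.vertex i) (P.vertex l),
    lorentz_comm (P.vertex j) (P.vertex l)]
  generalize lorentz (P.vertex i) (P.vertex j) = g at *
  generalize √(g ^ 2 - 1) = S at *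
  rw [← hsq]
  have e : g ^ 2 = S ^ 2 + 1 := by linarith
  field_simp
  ring_nf
  simp only [e, show g ^ 3 = g * (S ^ 2 + 1) by rw [← e]; ring,
    show g ^ 4 = (S ^ 2 + 1) ^ 2 by rw [← e]; ring]
  ring

/-- The dihedral angles are functions of the radii: the positive scaling factors of the two face
directions cancel in the quotient of minors. -/
theorem dihedralAngle_eq {r : Fin 4 → ℝ} (hr : ∀ a, 0 < r a)
    (hP : ∀ a b, a ≠ b → P.edgeLength a b = r a + r b) {a b : Fin 4} (hab : a ≠ b) :
    P.dihedralAngle a b (thirdIdx a b) (fourthIdx a b) = edgeAngle r a b := by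
  have hnd := thirdIdx_fourthIdx a b hab
  unfold edgeAngle
  generalize thirdIdx a b = c at *
  generalize fourthIdx a b = d at *
  simp only [List.nodup_cons, List.mem_cons, List.not_mem_nil, or_false, not_or] at hnd
  obtain ⟨⟨-, hac, had⟩, ⟨hbc, hbd⟩, hcd, -⟩ := hnd
  have hG : ∀ {x y : Fin 4}, x ≠ y → lorentz (P.vertex x) (P.vertex y) =
      -(Real.cosh (r x) * Real.cosh (r y) * (1 + Real.tanh (r x) * Real.tanh (r y))) := by
    intro x y hxy
    rw [P.lorentz_vertex_eq_neg_cosh hxy, hP x y hxy, neg_cosh_add_eq]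
  have hC : ∀ x, Real.cosh (r x) ^ 2 * (1 - Real.tanh (r x) ^ 2) = 1 := by
    intro x
    have h1 := (Real.cosh_pos (r x)).ne'
    rw [Real.tanh_eq_sinh_div_cosh]
    field_simp
    linarith [Real.cosh_sq (r x)]
  have ta := tanh_mem_Ioo (hr a)
  have tb := tanh_mem_Ioo (hr b)
  have hsum := (add_pos ta.1 tb.1).ne'
  have hdiag : ∀ x, x ≠ a → x ≠ b → lorentz (P.faceDir a b x) (P.faceDir a b x) =
      (2 * Real.cosh (r x) / (Real.tanh (r a) + Real.tanh (r b))) ^ 2 *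
        faceCofactor (Real.tanh (r a)) (Real.tanh (r b)) (Real.tanh (r x)) := by
    intro x hxa hxb
    rw [P.lorentz_faceDir hab, P.unit, hG hab, hG hxa, hG hxb,
      schur_complement_packingGram (hC a) (hC b) hsum]
    have := hC x
    unfold edgeCofactor faceCofactor
    field_simp
    linear_combination (-(Real.tanh (r a) + Real.tanh (r b)) ^ 2) * this
  have hoff : lorentz (P.faceDir a b c) (P.faceDir a b d) =
      (2 * Real.cosh (r c) / (Real.tanh (r a) + Real.tanh (r b))) *
      (2 * Real.cosh (r d) / (Real.tanh (r a) + Real.tanh (r b))) *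
        edgeCofactor (Real.tanh (r a)) (Real.tanh (r b)) (Real.tanh (r c)) (Real.tanh (r d)) := by
    rw [P.lorentz_faceDir hab, hG hab, hG (Ne.symm hac), hG (Ne.symm hbc), hG (Ne.symm had),
      hG (Ne.symm hbd), hG hcd, schur_complement_packingGram (hC a) (hC b) hsum]
    ring
  have hm : ∀ x, 0 < 2 * Real.cosh (r x) / (Real.tanh (r a) + Real.tanh (r b)) := fun x =>
    div_pos (mul_pos two_pos (Real.cosh_pos _)) (add_pos ta.1 tb.1)
  unfold dihedralAngle packingAngle
  rw [hdiag c (Ne.symm hac) (Ne.symm hbc),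
    hdiag d (Ne.symm had) (Ne.symm hbd), hoff, Real.sqrt_mul (sq_nonneg _),
    Real.sqrt_mul (sq_nonneg _), Real.sqrt_sq (hm c).le, Real.sqrt_sq (hm d).le]
  have h1 := (hm c).ne'
  have h2 := (hm d).ne'
  congr 1
  rw [mul_mul_mul_comm, mul_div_mul_left _ _ (mul_ne_zero h1 h2)]

end HyperIdealTet

/-! ### Existence of hyper-ideal tetrahedra -/

/-- The matrix `A = 2 - 1 1ᵀ - t tᵀ` is a Gram matrix for the Lorentzian inner product. -/
theorem exists_lorentz_gram (t : Fin 4 → ℝ) (ht : ∀ i, t i ∈ Set.Ioo (0 : ℝ) 1) :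
    ∃ w : Fin 4 → Fin 4 → ℝ,
      (∀ i j, lorentz (w i) (w j) = (if i = j then 2 else 0) - 1 - t i * t j) ∧
      ∀ i, 0 < w i 3 := by
  -- The rows of `h` are the vertices of a regular tetrahedron. Together with a constant column
  -- `1/2` they form an orthogonal matrix; `τ` and `p / 2` are the coordinates of `t` in the basis
  -- of its columns.
  let h : Fin 4 → Fin 3 → ℝ :=
    ![![1/2, 1/2, 1/2], ![1/2, -1/2, -1/2], ![-1/2, 1/2, -1/2], ![-1/2, -1/2, 1/2]]
  obtain ⟨p, hp⟩ : ∃ p, p = t 0 + t 1 + t 2 + t 3 := ⟨_, rfl⟩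
  obtain ⟨τ, hτ⟩ : ∃ τ : Fin 3 → ℝ, ∀ a, τ a =
    t 0 * h 0 a + t 1 * h 1 a + t 2 * h 2 a + t 3 * h 3 a := ⟨_, fun _ => rfl⟩
  obtain ⟨N, hN⟩ : ∃ N, N = τ 0 ^ 2 + τ 1 ^ 2 + τ 2 ^ 2 := ⟨_, rfl⟩
  have hp0 : 0 < p := by rw [hp]; linarith [(ht 0).1, (ht 1).1, (ht 2).1, (ht 3).1]
  have hN' : N = t 0 ^ 2 + t 1 ^ 2 + t 2 ^ 2 + t 3 ^ 2 - p ^ 2 / 4 := by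
    rw [hN, hτ, hτ, hτ, hp]; simp [h]; ring
  have hH : ∀ i j, h i 0 * h j 0 + h i 1 * h j 1 + h i 2 * h j 2 =
      (if i = j then 1 else 0) - 1 / 4 := by
    intro i j; fin_cases i <;> fin_cases j <;> simp [h] <;> norm_num
  have hT : ∀ i, τ 0 * h i 0 + τ 1 * h i 1 + τ 2 * h i 2 = t i - p / 4 := by
    intro i; rw [hτ, hτ, hτ, hp]; fin_cases i <;> simp [h] <;> ring
  have he0 : 0 < 2 + p ^ 2 / 4 := by positivity
  obtain ⟨e, hepos, he⟩ : ∃ e : ℝ, 0 < e ∧ e ^ 2 = 2 + p ^ 2 / 4 :=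
    ⟨_, Real.sqrt_pos.2 he0, Real.sq_sqrt he0.le⟩
  have hNe : N < e ^ 2 := by
    have := gramDisc_pos (ht 0) (ht 1) (ht 2) (ht 3)
    unfold gramDisc at this
    rw [← hp] at this
    rw [he, hN']
    linarith
  obtain ⟨ρ, hρpos, hρ⟩ : ∃ ρ : ℝ, 0 < ρ ∧ ρ ^ 2 = 1 - N / e ^ 2 := by
    have : 0 < 1 - N / e ^ 2 := by rw [sub_pos, div_lt_one (by positivity)]; exact hNe
    exact ⟨_, Real.sqrt_pos.2 this, Real.sq_sqrt this.le⟩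
  -- `κ` is the root of `2κ - κ²N = 1 / e²` which stays regular at `N = 0`. For this `κ` the map
  -- `√2 (1 - κ τ τᵀ)` is a square root of the positive definite form `2 - (2 / e²) τ τᵀ`, the
  -- spatial part of `A` after the timelike coordinate `(2 + p t) / (2e)` is split off.
  obtain ⟨κ, hκ⟩ : ∃ κ, κ = 1 / (e ^ 2 * (1 + ρ)) := ⟨_, rfl⟩
  have hκ' : 2 * κ - κ ^ 2 * N = 1 / e ^ 2 := by
    have hN2 : N = e ^ 2 * (1 - ρ ^ 2) := by rw [hρ]; field_simp; ring
    rw [hκ, hN2]; field_simp; ring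
  have h2 : √2 ^ 2 = (2 : ℝ) := Real.sq_sqrt zero_le_two
  refine ⟨fun i => ![√2 * (h i 0 - κ * (t i - p / 4) * τ 0),
    √2 * (h i 1 - κ * (t i - p / 4) * τ 1), √2 * (h i 2 - κ * (t i - p / 4) * τ 2),
    (2 + p * t i) / (2 * e)], fun i j => ?_, fun i => ?_⟩
  · have hω : (2 + p * t i) / (2 * e) * ((2 + p * t j) / (2 * e)) =
        (2 + p * t i) * (2 + p * t j) / 4 * (1 / e ^ 2) := by field_simp; ring
    have hs : (if i = j then (2 : ℝ) else 0) = 2 * (if i = j then 1 else 0) := by split_ifs <;> simp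
    have hle : lorentz ![√2 * (h i 0 - κ * (t i - p / 4) * τ 0),
        √2 * (h i 1 - κ * (t i - p / 4) * τ 1), √2 * (h i 2 - κ * (t i - p / 4) * τ 2),
        (2 + p * t i) / (2 * e)] ![√2 * (h j 0 - κ * (t j - p / 4) * τ 0),
        √2 * (h j 1 - κ * (t j - p / 4) * τ 1), √2 * (h j 2 - κ * (t j - p / 4) * τ 2),
        (2 + p * t j) / (2 * e)] =
        √2 ^ 2 * ((h i 0 * h j 0 + h i 1 * h j 1 + h i 2 * h j 2)
          - κ * (t j - p / 4) * (τ 0 * h i 0 + τ 1 * h i 1 + τ 2 * h i 2)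
          - κ * (t i - p / 4) * (τ 0 * h j 0 + τ 1 * h j 1 + τ 2 * h j 2)
          + κ ^ 2 * (t i - p / 4) * (t j - p / 4) * (τ 0 ^ 2 + τ 1 ^ 2 + τ 2 ^ 2))
        - (2 + p * t i) / (2 * e) * ((2 + p * t j) / (2 * e)) := by
      simp only [lorentz, Matrix.cons_val]; ring
    rw [hle, hH, hT, hT, ← hN, h2, hω, hs]
    have he1 : 1 / e ^ 2 * (2 + p ^ 2 / 4) = 1 := by rw [← he]; field_simp
    linear_combination -2 * (t i - p / 4) * (t j - p / 4) * hκ' - (1 / 2 + t i * t j) * he1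
  · have := mul_pos hp0 (ht i).1
    show 0 < (2 + p * t i) / (2 * e)
    positivity

/-- Every positive choice of radii is realized by a hyper-ideal tetrahedron. -/
theorem HyperIdealTet.exists_edgeLength_eq_add (r : Fin 4 → ℝ) (hr : ∀ i, 0 < r i) :
    ∃ P : HyperIdealTet, ∀ i j, i ≠ j → P.edgeLength i j = r i + r j := by
  obtain ⟨t, ht⟩ : ∃ t : Fin 4 → ℝ, ∀ i, t i = Real.tanh (r i) := ⟨_, fun _ => rfl⟩
  obtain ⟨c, hc⟩ : ∃ c : Fin 4 → ℝ, ∀ i, c i = Real.cosh (r i) := ⟨_, fun _ => rfl⟩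
  have htm : ∀ i, t i ∈ Set.Ioo (0 : ℝ) 1 := fun i => ht i ▸ tanh_mem_Ioo (hr i)
  have hc0 : ∀ i, 0 < c i := fun i => hc i ▸ Real.cosh_pos _
  have hct : ∀ i, c i ^ 2 * (1 - t i ^ 2) = 1 := by
    intro i
    have := (Real.cosh_pos (r i)).ne'
    rw [hc, ht, Real.tanh_eq_sinh_div_cosh]
    field_simp
    linarith [Real.cosh_sq (r i)]
  obtain ⟨w, hw, hw3⟩ := exists_lorentz_gram t htm
  have hg : ∀ i j, i ≠ j → lorentz (c i • w i) (c j • w j) = -Real.cosh (r i + r j) := by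
    intro i j hij
    rw [lorentz_smul_left, lorentz_smul_right, hw, if_neg hij, neg_cosh_add_eq, ← ht, ← ht, ← hc,
      ← hc]
    ring
  have hind : LinearIndependent ℝ w := by
    rw [Fintype.linearIndependent_iff]
    intro z hz
    have hj : ∀ j, z 0 * lorentz (w 0) (w j) + z 1 * lorentz (w 1) (w j)
        + z 2 * lorentz (w 2) (w j) + z 3 * lorentz (w 3) (w j) = 0 := by
      intro j
      have h0 : lorentz (∑ i, z i • w i) (w j) = 0 := by rw [hz]; simp [lorentz]
      rwa [Fin.sum_univ_four, lorentz_add_left, lorentz_add_left, lorentz_add_left,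
        lorentz_smul_left, lorentz_smul_left, lorentz_smul_left, lorentz_smul_left] at h0
    simp only [hw] at hj
    have h0 := hj 0
    have h1 := hj 1
    have h2 := hj 2
    have h3 := hj 3
    simp at h0 h1 h2 h3
    have hD := gramDisc_pos (htm 0) (htm 1) (htm 2) (htm 3)
    -- The kernel of `A` is contained in the span of `1` and `t`, so it is detected by the two sums
    -- `∑ z` and `∑ t z`, which satisfy a linear system of determinant proportional to `gramDisc`.
    have hT0 : t 0 * z 0 + t 1 * z 1 + t 2 * z 2 + t 3 * z 3 = 0 := by
      refine (mul_eq_zero.1 ?_).resolve_left hD.ne'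
      unfold gramDisc
      linear_combination -(t 0 + t 1 + t 2 + t 3) * (h0 + h1 + h2 + h3)
        + 2 * (t 0 * h0 + t 1 * h1 + t 2 * h2 + t 3 * h3)
    have hZ0 : z 0 + z 1 + z 2 + z 3 = 0 := by
      linear_combination (-1 / 2 : ℝ) * (h0 + h1 + h2 + h3) - (t 0 + t 1 + t 2 + t 3) / 2 * hT0
    intro i
    fin_cases i
    · change z 0 = 0
      linear_combination h0 / 2 + hZ0 / 2 + t 0 / 2 * hT0
    · change z 1 = 0
      linear_combination h1 / 2 + hZ0 / 2 + t 1 / 2 * hT0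
    · change z 2 = 0
      linear_combination h2 / 2 + hZ0 / 2 + t 2 / 2 * hT0
    · change z 3 = 0
      linear_combination h3 / 2 + hZ0 / 2 + t 3 / 2 * hT0
  let P : HyperIdealTet :=
    { vertex := fun i => c i • w i
      unit := fun i => by
        rw [lorentz_smul_left, lorentz_smul_right, hw, if_pos rfl]
        linear_combination hct i
      separated := fun i j hij => by
        rw [hg i j hij]
        linarith [Real.one_lt_cosh.2 (add_pos (hr i) (hr j)).ne']
      linearIndependent := hind.units_smul fun i => Units.mk0 (c i) (hc0 i).ne'
      future := fun i j _ => add_pos (mul_pos (hc0 i) (hw3 i)) (mul_pos (hc0 j) (hw3 j)) }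
  refine ⟨P, fun i j hij => ?_⟩
  rw [P.edgeLength_eq_arcosh hij]
  change Real.arcosh (-lorentz (c i • w i) (c j • w j)) = _
  rw [hg i j hij, neg_neg, Real.arcosh_cosh (add_pos (hr i) (hr j)).le]

/-! ### Scalar curvature -/

namespace SpherePackingMetric

variable {T : Type*} {G : TetGluing T}

theorem dihedralAngle_eq (m : SpherePackingMetric G) (σ : T) {a b : Fin 4} (hab : a ≠ b) :
    (m.tet σ).dihedralAngle a b (thirdIdx a b) (fourthIdx a b) =
      edgeAngle (fun c => m.radius (G.vert σ c)) a b :=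
  (m.tet σ).dihedralAngle_eq (fun _ => m.radius_pos _) (m.edgeLength_eq σ) hab

theorem exists_radius_eq (r : G.Vertex → ℝ) (hr : ∀ v, 0 < r v) :
    ∃ m : SpherePackingMetric G, m.radius = r := by
  choose P hP using fun σ => HyperIdealTet.exists_edgeLength_eq_add
    (fun a => r (G.vert σ a)) fun _ => hr _
  exact ⟨⟨r, hr, P, hP⟩, rfl⟩

variable [Fintype T]

theorem scalarCurvature_congr {m₁ m₂ : SpherePackingMetric G} (h : m₁.radius = m₂.radius) :
    m₁.scalarCurvature = m₂.scalarCurvature := by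
  have hr : ∀ e, m₁.ricci e = m₂.ricci e := by
    intro e
    unfold ricci
    congr 1
    refine Finset.sum_congr rfl fun c _ => ?_
    rw [m₁.dihedralAngle_eq _ c.2, m₂.dihedralAngle_eq _ c.2, h]
  ext v
  unfold scalarCurvature
  simp only [hr]

open Classical in
/-- The pairing of the scalar curvature with a function `x` on the vertices: up to a term that does
not depend on the metric, it is minus the sum of the angle pairings of the tetrahedra. -/
theorem sum_mul_scalarCurvature [Fintype G.Vertex] [Fintype G.OrientedEdge]
    (m : SpherePackingMetric G) (x : G.Vertex → ℝ) :
    ∑ v, x v * m.scalarCurvature v =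
      2 * Real.pi * ∑ e : G.OrientedEdge, x (G.start e)
        - ∑ σ, anglePairing (fun a => x (G.vert σ a)) (fun a => m.radius (G.vert σ a)) := by
  have h1 : ∀ v, x v * m.scalarCurvature v =
      ∑ e with G.start e = v, x (G.start e) * m.ricci e := by
    intro v
    unfold scalarCurvature
    rw [finsum_eq_sum_of_fintype, Finset.mul_sum,
      Finset.sum_subtype (p := fun e => G.start e = v) _ (by simp)]
    refine Finset.sum_congr rfl fun e _ => ?_
    rw [e.2]
  have h2 : ∀ e, x (G.start e) * m.ricci e = 2 * Real.pi * x (G.start e) -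
      ∑ c : TetGluing.EdgeCorner T with Quot.mk G.EdgeRel c = e, x (G.vert c.1.1 c.1.2.1) *
        edgeAngle (fun a => m.radius (G.vert c.1.1 a)) c.1.2.1 c.1.2.2 := by
    intro e
    unfold ricci
    rw [mul_sub, Finset.mul_sum, mul_comm (x _) (2 * Real.pi)]
    congr 1
    refine Finset.sum_congr rfl fun c hc => ?_
    rw [m.dihedralAngle_eq _ c.2, ← (Finset.mem_filter.1 hc).2]
    rfl
  have h3 : ∑ c : TetGluing.EdgeCorner T, x (G.vert c.1.1 c.1.2.1) *
        edgeAngle (fun a => m.radius (G.vert c.1.1 a)) c.1.2.1 c.1.2.2 =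
      ∑ σ, anglePairing (fun a => x (G.vert σ a)) (fun a => m.radius (G.vert σ a)) := by
    simp only [anglePairing_eq_sum]
    rw [← Finset.sum_subtype (Finset.univ.filter fun c : T × Fin 4 × Fin 4 => c.2.1 ≠ c.2.2)
      (by simp) (fun c => x (G.vert c.1 c.2.1) *
        edgeAngle (fun a => m.radius (G.vert c.1 a)) c.2.1 c.2.2), Finset.sum_filter,
      Fintype.sum_prod_type]
    simp only [Fintype.sum_prod_type]
  rw [Finset.sum_congr rfl fun v _ => h1 v,
    Finset.sum_fiberwise Finset.univ G.start (fun e => x (G.start e) * m.ricci e),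
    Finset.sum_congr rfl fun e _ => h2 e, Finset.sum_sub_distrib, ← Finset.mul_sum, ← h3]
  congr 1
  exact Finset.sum_fiberwise Finset.univ (fun c : TetGluing.EdgeCorner T => Quot.mk G.EdgeRel c) _

theorem radius_eq_of_scalarCurvature_eq {m₁ m₂ : SpherePackingMetric G}
    (h : m₁.scalarCurvature = m₂.scalarCurvature) : m₁.radius = m₂.radius := by
  classical
  have : Fintype G.Vertex := Fintype.ofFinite _
  have : Fintype G.OrientedEdge := Fintype.ofFinite _
  by_contra hne
  obtain ⟨v, hv⟩ := Function.ne_iff.1 hne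
  obtain ⟨⟨σ, a⟩, rfl⟩ := Quot.exists_rep v
  let r₁ : T → Fin 4 → ℝ := fun σ a => m₁.radius (G.vert σ a)
  let r₂ : T → Fin 4 → ℝ := fun σ a => m₂.radius (G.vert σ a)
  have hlt : ∀ σ, r₁ σ ≠ r₂ σ →
      anglePairing (r₂ σ - r₁ σ) (r₁ σ) < anglePairing (r₂ σ - r₁ σ) (r₂ σ) := fun σ hσ =>
    anglePairing_lt (fun _ => m₁.radius_pos _) (fun _ => m₂.radius_pos _) hσ
  have hsum : ∑ σ, anglePairing (fun a => (m₂.radius - m₁.radius) (G.vert σ a)) (r₁ σ) <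
      ∑ σ, anglePairing (fun a => (m₂.radius - m₁.radius) (G.vert σ a)) (r₂ σ) := by
    refine Finset.sum_lt_sum (fun τ _ => ?_) ⟨σ, Finset.mem_univ _, hlt σ fun h0 => hv ?_⟩
    · by_cases hτ : r₁ τ = r₂ τ
      · rw [hτ]
      · exact (hlt τ hτ).le
    · exact congrFun h0 a
  have e₁ := m₁.sum_mul_scalarCurvature (m₂.radius - m₁.radius)
  have e₂ := m₂.sum_mul_scalarCurvature (m₂.radius - m₁.radius)
  rw [h] at e₁
  exact hsum.ne (by linarith [e₁.symm.trans e₂])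

end SpherePackingMetric

theorem theorem1p3 {M : Type*} [TopologicalSpace M] [T2Space M] [CompactSpace M]
    [ChartedSpace (EuclideanHalfSpace 3) M] {T : Type*} [Fintype T]
    (𝒯 : IdealTriangulation M T) :
    (∀ r : 𝒯.toTetGluing.Vertex → ℝ, (∀ v, 0 < r v) →
      ∃ m : SpherePackingMetric 𝒯.toTetGluing, m.radius = r) ∧
    (∀ m₁ m₂ : SpherePackingMetric 𝒯.toTetGluing,
      m₁.radius = m₂.radius → m₁.scalarCurvature = m₂.scalarCurvature) ∧
    (∀ m₁ m₂ : SpherePackingMetric 𝒯.toTetGluing,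
      m₁.scalarCurvature = m₂.scalarCurvature → m₁.radius = m₂.radius) :=
  ⟨SpherePackingMetric.exists_radius_eq, fun _ _ => SpherePackingMetric.scalarCurvature_congr,
    fun _ _ => SpherePackingMetric.radius_eq_of_scalarCurvature_eq⟩
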